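/- Let $V$ be a finite set of points in the Euclidean plane and let $0<\theta<\pi/3$ and $r>0$. A geometric graph on $V$ is drawn with straight segments; its weight is the sum of the Euclidean lengths of its edges. A minimum spanning tree of $V$ is a minimum-weight spanning tree of the complete geometric graph on $V$. Bounded degree graph. Let $\mathcal{DT}(V)$ be a Delaunay triangulation of $V$ (a maximal plane graph on $V$ all of whose edges $ab$ admit a circle through $a$ and $b$ with no point of $V$ in its interior). For every $u\in V$ fix a partition of the plane into $\kappa=\lceil 2\pi/\theta\rceil$ disjoint cones with apex $u$, each of angle at most $\theta$. Let $v_0,\dots,v_m$ be the Delaunay neighbours of $u$ in one of these cones, in angular order. The edges $uv_0$ and $uv_m$ are extreme at $u$; the edges $uv_1$ and $uv_{m-1}$ are penultimate at $u$ if $m\ge 2$; and a shortest one of the remaining edges of $u$ in the cone (if there are any, which requires $m\ge 4$; ties are broken arbitrarily) is the middle edge of $u$ in this cone. An edge is protected at $u$ if it is extreme, penultimate or middle at $u$ in some cone. Let $G$ be the graph of all Delaunay edges that are protected at both of their endpoints. Pruning. Let $T_0$ be a minimum spanning tree of $G$. Start with the polygon $P$ being the Euler tour around $T_0$ (a degenerate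 polygon, in which every edge of $T_0$ occurs twice). The edges of $T_0$ are settled and included, and each of them has weight label $w(e)=|e|$; all other edges of $G$ are unsettled. As long as there are unsettled edges, choose an unsettled edge $pq$ and a path $\partial P(p,q)$ from $p$ to $q$ along $P$ such that $\partial P(p,q)$ together with $pq$ is the boundary of a bounded face of $G$ outside $P$. Let $S$ be the sum of the labels $w$ of the edges of $\partial P(p,q)$, counted with multiplicity. If $S>(1+1/r)\,|pq|$, then settle and include $pq$ and set $w(pq)=|pq|$; otherwise settle and exclude $pq$ and set $w(pq)=S$. In both cases replace $\partial P(p,q)$ in $P$ by the edge $pq$. When no unsettled edge is left, let $\mathcal{LMBDG}(V)$ be the graph on $V$ of all included edges. Then, for every choice of the Delaunay triangulation, of the cones, of the middle edges, of $T_0$ and of the order in which the edges are settled, the weight of $\mathcal{LMBDG}(V)$ is at most $(2r+1)$ times the weight of a minimum spanning tree of $V$. -/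

import Mathlib

open scoped Real

noncomputable section

namespace LightGraph

/-! The Euclidean plane is `ℂ`; a point set is `V : Finset ℂ`; a geometric graph on `V` is a
`SimpleGraph V`, drawn with straight segments. -/

/-- The length of an edge. -/
def len {V : Finset ℂ} (e : Sym2 V) : ℝ :=
  Sym2.lift ⟨fun a b => dist a b, fun a b => dist_comm a b⟩ e

/-- The weight of a geometric graph: the sum of the lengths of its edges. -/
def weight {V : Finset ℂ} (G : SimpleGraph V) : ℝ :=
  ∑ e ∈ (Set.toFinite G.edgeSet).toFinset, len e

/-- `T` is a minimum spanning tree of `G`. A minimum spanning tree of the point set `V` is one of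
the complete graph `⊤` on `V`. -/
def IsMST {V : Finset ℂ} (G T : SimpleGraph V) : Prop :=
  T ≤ G ∧ T.IsTree ∧ ∀ T' : SimpleGraph V, T' ≤ G → T'.IsTree → weight T ≤ weight T'

/-! ### Delaunay triangulations -/

/-- Some circle through `a` and `b` has no point of `V` in its interior. -/
def IsDelaunayPair {V : Finset ℂ} (a b : V) : Prop :=
  ∃ c : ℂ, dist (a : ℂ) c = dist (b : ℂ) c ∧ ∀ w : V, dist (a : ℂ) c ≤ dist (w : ℂ) c

/-- Distinct edges do not meet outside their endpoints. -/
def IsPlane {V : Finset ℂ} (G : SimpleGraph V) : Prop :=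
  ∀ a b c d : V, G.Adj a b → G.Adj c d → s(a, b) ≠ s(c, d) →
    Disjoint (openSegment ℝ (a : ℂ) (b : ℂ)) (openSegment ℝ (c : ℂ) (d : ℂ))

/-- A Delaunay triangulation of `V`: an inclusion-maximal plane graph all of whose edges have an
empty circle. When no four points of `V` lie on a common empty circle it is unique; in general it
triangulates each cocircular face of the Delaunay subdivision in an arbitrary way. -/
def IsDelaunayTriangulation (V : Finset ℂ) (D : SimpleGraph V) : Prop :=
  Maximal (fun G : SimpleGraph V => IsPlane G ∧ ∀ a b : V, G.Adj a b → IsDelaunayPair a b) D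

/-! ### The bounded degree graph -/

/-- The cross product of two plane vectors. -/
def cross (z w : ℂ) : ℝ := z.re * w.im - z.im * w.re

/-- `κ = ⌈2π/θ⌉`. -/
def kappa (θ : ℝ) : ℕ := ⌈2 * π / θ⌉₊

/-- `κ` disjoint convex cones with apex the origin that partition the plane (the apex aside), each
of angle measure at most `θ`. No convention is imposed on which of two adjacent cones contains
their common boundary ray. -/
def IsConePartition (θ : ℝ) (C : Fin (kappa θ) → ConvexCone ℝ ℂ) : Prop :=
  (∀ i, ∀ z ∈ C i, ∀ w ∈ C i, z ≠ 0 → w ≠ 0 → InnerProductGeometry.angle z w ≤ θ) ∧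
  (∀ z : ℂ, z ≠ 0 → ∃! i, z ∈ C i)

section Cone

variable {V : Finset ℂ} (D : SimpleGraph V) (K : ConvexCone ℝ ℂ)

/-- The neighbours of `u` in `D` that lie in the translate of the cone `K` to the apex `u`. -/
def coneNbrs (u : V) : Set V := {v | D.Adj u v ∧ (v : ℂ) - (u : ℂ) ∈ K}

/-- The neighbours of `u` in the cone that precede `v` in counterclockwise order. -/
def coneBefore (u v : V) : Set V :=
  {w ∈ coneNbrs D K u | 0 < cross ((w : ℂ) - u) ((v : ℂ) - u)}

/-- The neighbours of `u` in the cone that follow `v` in counterclockwise order. -/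
def coneAfter (u v : V) : Set V :=
  {w ∈ coneNbrs D K u | 0 < cross ((v : ℂ) - u) ((w : ℂ) - u)}

/-- `uv` is extreme at `u`: the first or the last edge of `u` in the cone. -/
def IsExtreme (u v : V) : Prop :=
  v ∈ coneNbrs D K u ∧ (coneBefore D K u v = ∅ ∨ coneAfter D K u v = ∅)

/-- `uv` is penultimate at `u`: the second or the second to last edge of `u` in the cone, and not
extreme (so that the cone contains at least three neighbours of `u`). -/
def IsPenultimate (u v : V) : Prop :=
  v ∈ coneNbrs D K u ∧ ¬ IsExtreme D K u v ∧
    ((coneBefore D K u v).ncard = 1 ∨ (coneAfter D K u v).ncard = 1)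

/-- The edges of `u` in the cone that are neither extreme nor penultimate. There are some only if
the cone contains at least five neighbours of `u`. -/
def coneRest (u : V) : Set V :=
  {v ∈ coneNbrs D K u | ¬ IsExtreme D K u v ∧ ¬ IsPenultimate D K u v}

end Cone

/-- `mid u i` is the other end of the middle edge of `u` in its `i`-th cone: a shortest one of the
edges that are neither extreme nor penultimate (ties are broken arbitrarily). Where there is no
such edge, `mid u i` is irrelevant. -/
def IsMiddleChoice {V : Finset ℂ} {k : ℕ} (D : SimpleGraph V) (C : V → Fin k → ConvexCone ℝ ℂ)
    (mid : V → Fin k → V) : Prop :=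
  ∀ u i, (coneRest D (C u i) u).Nonempty →
    mid u i ∈ coneRest D (C u i) u ∧ ∀ w ∈ coneRest D (C u i) u, dist u (mid u i) ≤ dist u w

/-- `uv` is protected at `u`: extreme, penultimate or middle in one of the cones of `u`. -/
def IsProtected {V : Finset ℂ} {k : ℕ} (D : SimpleGraph V) (C : V → Fin k → ConvexCone ℝ ℂ)
    (mid : V → Fin k → V) (u v : V) : Prop :=
  ∃ i, IsExtreme D (C u i) u v ∨ IsPenultimate D (C u i) u v ∨
    (v ∈ coneRest D (C u i) u ∧ v = mid u i)

/-- The graph of the edges of `D` that are protected at both endpoints. -/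
def bdg {V : Finset ℂ} {k : ℕ} (D : SimpleGraph V) (C : V → Fin k → ConvexCone ℝ ℂ)
    (mid : V → Fin k → V) : SimpleGraph V where
  Adj u v := D.Adj u v ∧ IsProtected D C mid u v ∧ IsProtected D C mid v u
  symm := ⟨fun _ _ h => ⟨h.1.symm, h.2.2, h.2.1⟩⟩
  loopless := ⟨fun _ h => D.loopless.irrefl _ h.1⟩

/-- `G` is a graph `BDG(V)` for the parameter `θ`, for some Delaunay triangulation, some cones at
each point and some choice of middle edges. The marked graph `MBDG(V)` is this graph with
additional information stored at the vertices. -/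
def IsBDG (V : Finset ℂ) (θ : ℝ) (G : SimpleGraph V) : Prop :=
  ∃ (D : SimpleGraph V) (C : V → Fin (kappa θ) → ConvexCone ℝ ℂ) (mid : V → Fin (kappa θ) → V),
    IsDelaunayTriangulation V D ∧ (∀ u, IsConePartition θ (C u)) ∧ IsMiddleChoice D C mid ∧
    G = bdg D C mid

/-! ### Boundary walks

A closed walk is a cyclic sequence of directed edges. -/

/-- The counterclockwise angle, in `(0, 2π]`, from the ray `ub` to the ray `ua`. -/
def sweep {V : Finset ℂ} (u b a : V) : ℝ :=
  toIocMod Real.two_pi_pos 0 (Complex.arg (((a : ℂ) - u) / ((b : ℂ) - u)))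

/-- The directed edges `e = (a, u)` and `f = (u, b)` are consecutive on the boundary walk of the
face of `G` to their left: in counterclockwise order around `u`, starting from `ub`, the first edge
of `G` at `u` is `ua` (and `a = b` if `u` has degree one). -/
def FaceNext {V : Finset ℂ} (G : SimpleGraph V) (e f : V × V) : Prop :=
  G.Adj e.1 e.2 ∧ G.Adj f.1 f.2 ∧ e.2 = f.1 ∧
    ∀ c, G.Adj e.2 c → sweep e.2 f.2 e.1 ≤ sweep e.2 f.2 c

/-- The Euler tour around the plane tree `T`, with the exterior to the left: it uses every edge of
`T` exactly once in each direction. -/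
def IsEulerTour {V : Finset ℂ} (T : SimpleGraph V) (P : Cycle (V × V)) : Prop :=
  P.Nodup ∧ (∀ a b, (a, b) ∈ P ↔ T.Adj a b) ∧ P.Chain (FaceNext T)

/-- Twice the signed area enclosed by a closed walk (shoelace formula). -/
def twiceArea {V : Finset ℂ} (l : List (V × V)) : ℝ :=
  (l.map fun e => cross (e.1 : ℂ) (e.2 : ℂ)).sum

/-- The closed walk `l` is the boundary walk of a bounded face of the connected plane graph `G`,
with the face to its left. (The boundary walk of the unbounded face, with that face to its left,
goes clockwise and has nonpositive signed area.) -/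
def IsCellBoundary {V : Finset ℂ} (G : SimpleGraph V) (l : List (V × V)) : Prop :=
  Cycle.Chain (FaceNext G) (l : Cycle (V × V)) ∧ 0 < twiceArea l

/-! ### The protocol of Levcopoulos and Lingas -/

/-- A state of the protocol: the polygon `P`, traversed with its exterior to the left, the included
and the excluded settled edges, and the `weight` of the settled edges (its values on unsettled edges
are irrelevant). -/
structure LLState (V : Finset ℂ) where
  polygon : Cycle (V × V)
  included : Set (Sym2 V)
  excluded : Set (Sym2 V)
  wt : Sym2 V → ℝ

/-- An edge of `G` that is not settled yet. -/
def LLState.Unsettled {V : Finset ℂ} (σ : LLState V) (G : SimpleGraph V) (e : Sym2 V) : Prop :=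
  e ∈ G.edgeSet ∧ e ∉ σ.included ∧ e ∉ σ.excluded

/-- The initial state: the edges of the minimum spanning tree are included with their lengths as
weights, and the polygon is the Euler tour. -/
def LLState.init {V : Finset ℂ} (T : SimpleGraph V) (P : Cycle (V × V)) : LLState V :=
  ⟨P, T.edgeSet, ∅, len⟩

/-- The sum of the weights of the edges along a path (an edge that is traversed twice counts
twice). -/
def LLState.pathWeight {V : Finset ℂ} (σ : LLState V) (path : List (V × V)) : ℝ :=
  (path.map fun e => σ.wt s(e.1, e.2)).sum

/-- The polygon consists of the path `path` from `p` to `q` followed by `rest`, the edge `pq` is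
unsettled, and `path` together with `pq` bounds a cell. -/
structure LLState.CanExpand {V : Finset ℂ} (σ : LLState V) (G : SimpleGraph V) (p q : V)
    (path rest : List (V × V)) : Prop where
  polygon_eq : σ.polygon = ((path ++ rest : List (V × V)) : Cycle (V × V))
  unsettled : σ.Unsettled G s(p, q)
  cell : IsCellBoundary G (path ++ [(q, p)])

open Classical in
/-- One step of the protocol: the polygon is expanded over a cell, `path` being replaced by the
edge `pq`, which is settled: it is included, with weight `|pq|`, if the weight `S` of `path` exceeds
`(1 + 1/r)|pq|`, and otherwise it is excluded, with weight `S`. -/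
inductive LLStep {V : Finset ℂ} (G : SimpleGraph V) (r : ℝ) : LLState V → LLState V → Prop
  | include_edge (σ : LLState V) (p q : V) (path rest : List (V × V))
      (h : σ.CanExpand G p q path rest)
      (hS : (1 + 1 / r) * dist p q < σ.pathWeight path) :
      LLStep G r σ
        ⟨(((p, q) :: rest : List (V × V)) : Cycle (V × V)), insert s(p, q) σ.included, σ.excluded,
          Function.update σ.wt s(p, q) (dist p q)⟩
  | exclude_edge (σ : LLState V) (p q : V) (path rest : List (V × V))
      (h : σ.CanExpand G p q path rest)
      (hS : σ.pathWeight path ≤ (1 + 1 / r) * dist p q) :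
      LLStep G r σ
        ⟨(((p, q) :: rest : List (V × V)) : Cycle (V × V)), σ.included, insert s(p, q) σ.excluded,
          Function.update σ.wt s(p, q) (σ.pathWeight path)⟩

/-- `L` is an output of the protocol on the plane graph `G` with parameter `r`: it consists of the
included edges once no edge of `G` is unsettled. -/
def IsLLOutput {V : Finset ℂ} (G : SimpleGraph V) (r : ℝ) (L : SimpleGraph V) : Prop :=
  ∃ (T : SimpleGraph V) (P : Cycle (V × V)) (σ : LLState V),
    IsMST G T ∧ IsEulerTour T P ∧ Relation.ReflTransGen (LLStep G r) (LLState.init T P) σ ∧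
    (∀ e, ¬ σ.Unsettled G e) ∧ L = SimpleGraph.fromEdgeSet σ.included

/-- `L` is a graph `LMBDG(V)` for the parameters `θ` and `r`. -/
def IsLMBDG (V : Finset ℂ) (θ r : ℝ) (L : SimpleGraph V) : Prop :=
  ∃ G : SimpleGraph V, IsBDG V θ G ∧ IsLLOutput G r L

end LightGraph

end

open scoped Real

/-! The bound combines a potential argument with a containment.

Potential: let Φ be the length of the included edges plus `r` times the labelled perimeter of the
polygon. Excluding `pq` leaves Φ unchanged, since the label of `pq` is the weight `S` of the path it
replaces. Including `pq` adds `|pq|` to the length and lowers the perimeter by `S - |pq| > |pq| /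
r`, so Φ drops. The Euler tour has perimeter at most twice the weight of `T₀`, so Φ starts at no
more than `(2r + 1)` times that weight, and it always bounds the included length
(`weight_le_of_isLLOutput`).

Containment: `T₀` is no heavier than a minimum spanning tree of `V`, because the bounded degree
graph contains one (`IsMST.exists_le_bdg`). All edges of a minimum spanning tree are Delaunay. If
one of them, `uv`, is not protected at `u`, the middle edge `uw` of its cone can replace it: cones
are narrower than 60°, so `vw` is shorter than `uv`. The edge `uw` is protected at `w` as well,
because an edge of a minimum spanning tree is extreme at one of its ends (`IsMST.isExtreme_or`);
otherwise two Delaunay edges would cross. -/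

namespace LightGraph

/-! ### Edge exchange in minimum spanning trees. -/

section MST

variable {V : Finset ℂ}

theorem len_mk (a b : V) : len s(a, b) = dist (a : ℂ) b := rfl

theorem len_nonneg (e : Sym2 V) : 0 ≤ len e := by
  induction e with
  | h a b => rw [len_mk]; exact dist_nonneg

theorem weight_eq_sum {G : SimpleGraph V} {s : Finset (Sym2 V)} (h : (s : Set (Sym2 V)) = G.edgeSet) :
    weight G = ∑ e ∈ s, len e := by
  unfold weight
  congr 1
  ext e
  simp [← h]

/-- The graph obtained from `T` by replacing the edge `e` by the edge `f`. -/
def exchange (T : SimpleGraph V) (e f : Sym2 V) : SimpleGraph V :=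
  SimpleGraph.fromEdgeSet (insert f (T.edgeSet \ {e}))

theorem edgeSet_exchange (T : SimpleGraph V) (e : Sym2 V) {a b : V} (hab : a ≠ b) :
    (exchange T e s(a, b)).edgeSet = insert s(a, b) (T.edgeSet \ {e}) := by
  rw [exchange, SimpleGraph.edgeSet_fromEdgeSet, sdiff_eq_left, Set.disjoint_left]
  rintro f (rfl | ⟨hf, -⟩) hd
  · exact hab (by simpa using hd)
  · exact T.not_isDiag_of_mem_edgeSet hf hd

theorem weight_exchange_le (T : SimpleGraph V) {e : Sym2 V} (he : e ∈ T.edgeSet) {a b : V}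
    (hab : a ≠ b) : weight (exchange T e s(a, b)) ≤ weight T - len e + dist (a : ℂ) b := by
  classical
  set s := (Set.toFinite T.edgeSet).toFinset with hs
  have hes : e ∈ s := by simpa [hs] using he
  rw [weight_eq_sum (s := insert s(a, b) (s.erase e))
    (by rw [edgeSet_exchange T e hab]; simp [hs]), weight_eq_sum (G := T) (s := s) (by simp [hs]),
    ← Finset.add_sum_erase s len hes, ← len_mk]
  -- The new edge may already belong to the tree, which is why the result is only an inequality.
  by_cases h : s(a, b) ∈ s.erase e
  · rw [Finset.insert_eq_self.2 h]
    linarith [len_nonneg s(a, b)]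
  · rw [Finset.sum_insert h]
    linarith

theorem reachable_deleteEdges_or {T : SimpleGraph V} {u v : V} (hT : T.Connected) (w : V) :
    (T.deleteEdges {s(u, v)}).Reachable w u ∨ (T.deleteEdges {s(u, v)}).Reachable w v := by
  obtain ⟨p⟩ := hT.preconnected w u
  induction p with
  | nil => exact .inl .rfl
  | @cons a b c h p ih =>
    by_cases he : s(a, b) = s(c, v)
    · rcases Sym2.eq_iff.1 he with ⟨rfl, -⟩ | ⟨rfl, -⟩
      · exact .inl .rfl
      · exact .inr .rfl
    · have hr : (T.deleteEdges {s(c, v)}).Reachable a b :=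
        SimpleGraph.Adj.reachable (by simp [SimpleGraph.deleteEdges_adj, h, he])
      exact ih.imp hr.trans hr.trans

/-- The new edge reconnects the two components of `T` minus `uv`, and a connected graph with no more
edges than a tree on the same vertices is a tree. -/
theorem isTree_exchange {T : SimpleGraph V} (hT : T.IsTree) {u v a b : V} (huv : T.Adj u v)
    (hab : a ≠ b) (ha : (T.deleteEdges {s(u, v)}).Reachable a u)
    (hb : (T.deleteEdges {s(u, v)}).Reachable b v) : (exchange T s(u, v) s(a, b)).IsTree := by
  set T' := exchange T s(u, v) s(a, b) with hT'
  have hle : T.deleteEdges {s(u, v)} ≤ T' := by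
    rw [← SimpleGraph.edgeSet_subset_edgeSet, hT', edgeSet_exchange T _ hab,
      SimpleGraph.edgeSet_deleteEdges]
    exact Set.subset_insert _ _
  have habT : T'.Adj a b := by
    rw [← SimpleGraph.mem_edgeSet, hT', edgeSet_exchange T _ hab]
    exact Set.mem_insert _ _
  have huv' : T'.Reachable v u :=
    ((hb.mono hle).symm.trans habT.symm.reachable).trans (ha.mono hle)
  have hu : ∀ w, T'.Reachable w u := fun w =>
    (reachable_deleteEdges_or (u := u) (v := v) hT.connected w).elim (fun h => h.mono hle)
      fun h => (h.mono hle).trans huv'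
  have hne : Nonempty V := ⟨u⟩
  have hconn : T'.Connected := ⟨fun x y => (hu x).trans (hu y).symm⟩
  rw [SimpleGraph.isTree_iff_connected_and_card]
  refine ⟨hconn, le_antisymm ?_ hconn.card_vert_le_card_edgeSet_add_one⟩
  rw [← (SimpleGraph.isTree_iff_connected_and_card.1 hT).2, Nat.card_coe_set_eq,
    Nat.card_coe_set_eq, hT', edgeSet_exchange T _ hab]
  have h1 := Set.ncard_insert_le s(a, b) (T.edgeSet \ {s(u, v)})
  have h2 := Set.ncard_sdiff_singleton_add_one (s := T.edgeSet) (a := s(u, v)) huv (Set.toFinite _)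
  omega

/-- If `uv` is an edge of a minimum spanning tree and `vw` is shorter than `uv`, then `uw` may
replace `uv` in the tree. -/
theorem IsMST.isTree_exchange {T : SimpleGraph V} (hT : IsMST ⊤ T) {u v w : V} (huv : T.Adj u v)
    (hwv : w ≠ v) (hvw : dist (v : ℂ) w < dist (u : ℂ) v) :
    u ≠ w ∧ (exchange T s(u, v) s(u, w)).IsTree := by
  -- If `w` were on the side of `u`, replacing `uv` by the shorter `wv` would give a lighter tree.
  have hw : (T.deleteEdges {s(u, v)}).Reachable w v := by
    refine (reachable_deleteEdges_or (u := u) (v := v) hT.2.1.connected w).resolve_left fun h => ?_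
    have := hT.2.2 _ le_top (LightGraph.isTree_exchange hT.2.1 huv hwv h .rfl)
    have h2 := weight_exchange_le T (e := s(u, v)) huv hwv
    rw [len_mk, dist_comm (w : ℂ)] at h2
    linarith
  have huw : u ≠ w := by
    rintro rfl
    rw [dist_comm] at hvw
    exact lt_irrefl _ hvw
  exact ⟨huw, LightGraph.isTree_exchange hT.2.1 huv huw .rfl hw⟩

/-- A tree edge is never strictly the longest side of a triangle with vertices in `V`. -/
theorem IsMST.dist_le {T : SimpleGraph V} (hT : IsMST ⊤ T) {u v w : V} (huv : T.Adj u v)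
    (hwv : w ≠ v) (hvw : dist (v : ℂ) w < dist (u : ℂ) v) : dist (u : ℂ) v ≤ dist (u : ℂ) w := by
  obtain ⟨huw, h⟩ := hT.isTree_exchange huv hwv hvw
  have h1 := hT.2.2 _ le_top h
  have h2 := weight_exchange_le T (e := s(u, v)) huv huw
  rw [len_mk] at h2
  linarith

theorem IsMST.exchange {T : SimpleGraph V} (hT : IsMST ⊤ T) {u v w : V} (huv : T.Adj u v)
    (hwv : w ≠ v) (hvw : dist (v : ℂ) w < dist (u : ℂ) v) (huw : dist (u : ℂ) w ≤ dist (u : ℂ) v) :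
    u ≠ w ∧ IsMST ⊤ (exchange T s(u, v) s(u, w)) := by
  obtain ⟨hne, h⟩ := hT.isTree_exchange huv hwv hvw
  refine ⟨hne, le_top, h, fun T' hT' ht => (le_trans ?_ (hT.2.2 T' hT' ht))⟩
  have h2 := weight_exchange_le T (e := s(u, v)) huv hne
  rw [len_mk] at h2
  linarith

end MST

end LightGraph

namespace LightGraph

/-! ### Plane geometry: angles below 60° and crossing segments. -/

section Geometry

/-- Law of cosines: `‖z - w‖² < ‖z‖² + ‖w‖² - ‖z‖‖w‖ ≤ ‖z‖²`. -/
theorem norm_sub_lt_of_angle_lt {z w : ℂ} (hw : w ≠ 0) (hle : ‖w‖ ≤ ‖z‖)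
    (h : InnerProductGeometry.angle z w < π / 3) : ‖z - w‖ < ‖z‖ := by
  have hw' : 0 < ‖w‖ := norm_pos_iff.2 hw
  have hcos : 1 / 2 < Real.cos (InnerProductGeometry.angle z w) := by
    rw [← Real.cos_pi_div_three]
    exact Real.cos_lt_cos_of_nonneg_of_le_pi (InnerProductGeometry.angle_nonneg _ _)
      (by linarith [Real.pi_pos]) h
  have h1 := InnerProductGeometry.cos_angle_mul_norm_mul_norm z w
  have h2 := norm_sub_sq_real z w
  have h3 : 1 / 2 * (‖z‖ * ‖w‖) < inner ℝ z w := by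
    rw [← h1]
    exact mul_lt_mul_of_pos_right hcos (mul_pos (hw'.trans_le hle) hw')
  refine lt_of_pow_lt_pow_left₀ 2 (norm_nonneg _) ?_
  nlinarith

theorem norm_lt_two_mul_re_of_angle_lt {z : ℂ} (hz : z ≠ 0)
    (h : InnerProductGeometry.angle 1 z < π / 3) : ‖z‖ < 2 * z.re := by
  have hcos : 1 / 2 < Real.cos (InnerProductGeometry.angle 1 z) := by
    rw [← Real.cos_pi_div_three]
    exact Real.cos_lt_cos_of_nonneg_of_le_pi (InnerProductGeometry.angle_nonneg _ _)
      (by linarith [Real.pi_pos]) h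
  have h1 := InnerProductGeometry.cos_angle_mul_norm_mul_norm 1 z
  simp [Complex.inner] at h1
  have : 0 < ‖z‖ := norm_pos_iff.2 hz
  nlinarith

/-- For `p < 1` the claim says that the slope `n / m < √3` is below `q / (1 - p)`. Indeed `p + iq`
lies outside the unit disc with `p > 1/2`, so `q² ≥ (1 - p)(1 + p) ≥ 3(1 - p)²`: the equilateral
triangle on `[0, 1]` is the limiting case. -/
theorem im_lt_cross_aux {p q m n : ℝ} (hq : 0 < q) (hm : 0 < m) (hn : 0 < n)
    (hp : 0 < p) (hpq1 : 1 ≤ p ^ 2 + q ^ 2) (hpq : p ^ 2 + q ^ 2 < 4 * p ^ 2)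
    (hmn : m ^ 2 + n ^ 2 < 4 * m ^ 2) : n < p * n + q * m := by
  rcases le_or_gt 1 p with h | h
  · nlinarith [mul_pos hq hm]
  · have hp2 : 1 / 2 < p := by nlinarith
    have h3 : 3 * (1 - p) ^ 2 ≤ q ^ 2 := by nlinarith
    have h4 : (n * (1 - p)) ^ 2 < (q * m) ^ 2 := by
      have : n ^ 2 < 3 * m ^ 2 := by linarith
      have h5 : 0 < (1 - p) ^ 2 := by have : 0 < 1 - p := by linarith
                                      positivity
      calc (n * (1 - p)) ^ 2 = n ^ 2 * (1 - p) ^ 2 := by ring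
        _ < 3 * m ^ 2 * (1 - p) ^ 2 := by gcongr
        _ = 3 * (1 - p) ^ 2 * m ^ 2 := by ring
        _ ≤ q ^ 2 * m ^ 2 := by gcongr
        _ = (q * m) ^ 2 := by ring
    have := lt_of_pow_lt_pow_left₀ 2 (by positivity) h4
    linarith

theorem cross_mul_left (d z w : ℂ) : cross (d * z) (d * w) = ‖d‖ ^ 2 * cross z w := by
  rw [← Complex.normSq_eq_norm_sq, Complex.normSq_apply]
  simp only [cross, Complex.mul_re, Complex.mul_im]
  ring

/-- Two segments that start at the ends of `uv`, on the same side, at angles less than `π / 3` to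
`uv`, and that are at least as long as `uv`, cross. -/
theorem not_disjoint_openSegment {u v x y : ℂ} (huv : u ≠ v)
    (hx : InnerProductGeometry.angle (v - u) (x - u) < π / 3)
    (hy : InnerProductGeometry.angle (u - v) (y - v) < π / 3)
    (hux : dist u v ≤ dist u x) (hvy : dist v u ≤ dist v y)
    (hcx : 0 < cross (v - u) (x - u)) (hcy : 0 < cross (y - v) (u - v)) :
    ¬ Disjoint (openSegment ℝ u x) (openSegment ℝ v y) := by
  have hd : v - u ≠ 0 := sub_ne_zero.2 huv.symm
  have hdn : 0 < ‖v - u‖ := norm_pos_iff.2 hd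
  set d := v - u with hd_def
  -- Coordinates with `u = 0` and `v = 1`; `w` is measured from `v` towards `u`, so the same side of
  -- `uv` means `z.im > 0` and `w.im < 0`.
  obtain ⟨z, hz⟩ : ∃ z, x - u = d * z := ⟨(x - u) / d, by field_simp⟩
  obtain ⟨w, hw⟩ : ∃ w, y - v = -d * w := ⟨(y - v) / -d, by field_simp⟩
  have huv' : u - v = -d := by rw [hd_def]; ring
  rw [hz] at hcx
  rw [huv', hw] at hcy
  have hcx' : 0 < z.im := by
    have := cross_mul_left d 1 z
    rw [mul_one] at this
    rw [this] at hcx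
    have := pos_of_mul_pos_right hcx (by positivity)
    simpa [cross] using this
  have hcy' : w.im < 0 := by
    have := cross_mul_left (-d) w 1
    rw [mul_one] at this
    rw [this] at hcy
    have := pos_of_mul_pos_right hcy (by positivity)
    simpa [cross] using this
  have hz0 : z ≠ 0 := by rintro rfl; simp at hcx'
  have hw0 : w ≠ 0 := by rintro rfl; simp at hcy'
  rw [hz] at hx
  rw [huv', hw] at hy
  have hx' : InnerProductGeometry.angle 1 z < π / 3 := by
    have := Complex.angle_mul_left hd 1 z
    rw [mul_one] at this
    rwa [← this]
  have hy' : InnerProductGeometry.angle 1 w < π / 3 := by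
    have := Complex.angle_mul_left (neg_ne_zero.2 hd) 1 w
    rw [mul_one] at this
    rwa [← this]
  have hzr := norm_lt_two_mul_re_of_angle_lt hz0 hx'
  have hwr := norm_lt_two_mul_re_of_angle_lt hw0 hy'
  have hz1 : 1 ≤ ‖z‖ := by
    rw [dist_comm, dist_eq_norm, dist_comm, dist_eq_norm, hz, ← hd_def, norm_mul] at hux
    nlinarith
  have hw1 : 1 ≤ ‖w‖ := by
    rw [dist_comm, dist_eq_norm, dist_comm, dist_eq_norm, hw, huv', norm_mul, norm_neg] at hvy
    nlinarith
  have hzn : ‖z‖ ^ 2 = z.re ^ 2 + z.im ^ 2 := by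
    rw [← Complex.normSq_eq_norm_sq, Complex.normSq_apply]; ring
  have hwn : ‖w‖ ^ 2 = w.re ^ 2 + w.im ^ 2 := by
    rw [← Complex.normSq_eq_norm_sq, Complex.normSq_apply]; ring
  have hzp : 0 < z.re := by linarith
  have hwp : 0 < w.re := by linarith
  have k1 : 1 ≤ z.re ^ 2 + z.im ^ 2 := by nlinarith
  have k2 : z.re ^ 2 + z.im ^ 2 < 4 * z.re ^ 2 := by nlinarith
  have k3 : 1 ≤ w.re ^ 2 + (-w.im) ^ 2 := by nlinarith
  have k4 : w.re ^ 2 + (-w.im) ^ 2 < 4 * w.re ^ 2 := by nlinarith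
  have c1 := im_lt_cross_aux hcx' hwp (neg_pos.2 hcy') hzp k1 k2 k4
  have c2 := im_lt_cross_aux (neg_pos.2 hcy') hzp hcx' hwp k3 k4 k2
  set Δ := z.re * -w.im + z.im * w.re with hΔ
  have hΔ0 : 0 < Δ := by linarith
  rw [Set.not_disjoint_iff]
  -- Cramer's rule for `s z = 1 - t w`; `c1` and `c2` say that `s` and `t` are less than 1.
  refine ⟨u + (-w.im / Δ : ℝ) • (x - u), ?_, ?_⟩
  · rw [openSegment_eq_image']
    exact ⟨-w.im / Δ, ⟨div_pos (by linarith) hΔ0, (div_lt_one hΔ0).2 c1⟩, rfl⟩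
  · rw [openSegment_eq_image']
    refine ⟨z.im / Δ, ⟨div_pos hcx' hΔ0, (div_lt_one hΔ0).2 (by linarith)⟩, ?_⟩
    have hv : v = u + d := by rw [hd_def]; ring
    simp only []
    rw [hz, hw]
    conv_lhs => rw [hv]
    have key : (1 : ℂ) - (z.im / Δ : ℝ) * w = (-w.im / Δ : ℝ) * z := by
      apply Complex.ext
      · simp
        field_simp
        rw [hΔ]; ring
      · simp
        field_simp
    rw [Complex.real_smul, Complex.real_smul]
    linear_combination d * key

variable {V : Finset ℂ}

/-- If the closed disc with diameter `uv` contains no other point of `V`, then `uv` does not cross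
any Delaunay edge. -/
theorem disjoint_openSegment_of_isDelaunayPair {u v a b : V}
    (huv : ∀ w : V, w ≠ u → w ≠ v →
      0 < ((w : ℂ) - u).re * ((w : ℂ) - v).re + ((w : ℂ) - u).im * ((w : ℂ) - v).im)
    (hne : s(u, v) ≠ s(a, b)) (hab : a ≠ b) (h : IsDelaunayPair a b) :
    Disjoint (openSegment ℝ (u : ℂ) v) (openSegment ℝ (a : ℂ) b) := by
  obtain ⟨c, hc, hw⟩ := h
  -- `F` and `g` are the powers of a point with respect to the diametral circle of `uv` and the
  -- empty circle of `ab`. Their difference is affine; it is at most 0 on `uv` and at least 0 on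
  -- `ab`, so a common point forces `F` to vanish at `a` and `b`.
  set F : ℂ → ℝ := fun x => (x - u).re * (x - v).re + (x - u).im * (x - v).im with hF
  set g : ℂ → ℝ := fun x => (x - c).re ^ 2 + (x - c).im ^ 2 - dist (a : ℂ) c ^ 2 with hg
  have hdist : ∀ x : ℂ, (x - c).re ^ 2 + (x - c).im ^ 2 = dist x c ^ 2 := fun x => by
    rw [dist_eq_norm, ← Complex.normSq_eq_norm_sq, Complex.normSq_apply]; ring
  have hga : g a = 0 := by simp only [hg, hdist]; ring
  have hgb : g b = 0 := by simp only [hg, hdist, hc]; ring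
  have hgn : ∀ w : V, 0 ≤ g w := fun w => by
    simp only [hg, hdist]
    have := hw w
    have h0 : 0 ≤ dist (a : ℂ) c := dist_nonneg
    nlinarith
  have hFu : F u = 0 := by simp [hF]
  have hFv : F v = 0 := by simp [hF]
  have hFn : ∀ w : V, 0 ≤ F w := fun w => by
    by_cases h1 : w = u
    · rw [h1, hFu]
    by_cases h2 : w = v
    · rw [h2, hFv]
    exact (huv w h1 h2).le
  have haff : ∀ (s t : ℝ) (x y : ℂ), s + t = 1 →
      F (s • x + t • y) - g (s • x + t • y) = s * (F x - g x) + t * (F y - g y) := by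
    intro s t x y hst
    obtain rfl : t = 1 - s := by linarith
    simp [hF, hg]
    ring
  rw [Set.disjoint_left]
  rintro x ⟨s, t, hs, ht, hst, rfl⟩ ⟨s', t', hs', ht', hst', hx⟩
  have h1 := haff s t u v hst
  have h2 := haff s' t' a b hst'
  rw [hx, h1, hFu, hFv, hga, hgb] at h2
  have hFa : F a = 0 := by
    nlinarith [mul_nonneg hs.le (hgn u), mul_nonneg ht.le (hgn v), mul_nonneg hs'.le (hFn a),
      mul_nonneg ht'.le (hFn b), hFn a]
  have hFb : F b = 0 := by
    nlinarith [mul_nonneg hs.le (hgn u), mul_nonneg ht.le (hgn v), mul_nonneg hs'.le (hFn a),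
      mul_nonneg ht'.le (hFn b), hFn b]
  have hmem : ∀ w : V, F w = 0 → w = u ∨ w = v := fun w h0 => by
    by_contra hcon
    rw [not_or] at hcon
    exact (huv w hcon.1 hcon.2).ne' h0
  rcases hmem a hFa with rfl | rfl <;> rcases hmem b hFb with rfl | rfl
  · exact hab rfl
  · exact hne rfl
  · exact hne Sym2.eq_swap
  · exact hab rfl

end Geometry

end LightGraph

namespace LightGraph

/-! ### The bounded degree graph contains a minimum spanning tree. -/

section Containment

variable {V : Finset ℂ}

theorem coe_ne {u v : V} (h : u ≠ v) : (u : ℂ) ≠ v := fun h' => h (Subtype.ext h')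

/-- The closed disc whose diameter is an edge of a minimum spanning tree is empty. -/
theorem IsMST.diametral_disc {T : SimpleGraph V} (hT : IsMST ⊤ T) {u v : V} (huv : T.Adj u v)
    (w : V) (hwu : w ≠ u) (hwv : w ≠ v) :
    0 < ((w : ℂ) - u).re * ((w : ℂ) - v).re + ((w : ℂ) - u).im * ((w : ℂ) - v).im := by
  by_contra! hcon
  have hsq : ∀ x y : ℂ, dist x y ^ 2 = (y - x).re ^ 2 + (y - x).im ^ 2 := fun x y => by
    rw [dist_comm, dist_eq_norm, ← Complex.normSq_eq_norm_sq, Complex.normSq_apply]; ring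
  have h1 : 0 < dist (u : ℂ) w := dist_pos.2 (coe_ne hwu.symm)
  have h2 : 0 < dist (v : ℂ) w := dist_pos.2 (coe_ne hwv.symm)
  -- The angle at `w` is at least 90°, which makes `uv` strictly the longest side.
  have h3 : dist (u : ℂ) w ^ 2 + dist (v : ℂ) w ^ 2 ≤ dist (u : ℂ) v ^ 2 := by
    rw [hsq, hsq, hsq]
    simp only [Complex.sub_re, Complex.sub_im] at hcon ⊢
    nlinarith
  have h4 : dist (v : ℂ) w < dist (u : ℂ) v :=
    lt_of_pow_lt_pow_left₀ 2 dist_nonneg (by nlinarith)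
  have h5 : dist (u : ℂ) w < dist (u : ℂ) v :=
    lt_of_pow_lt_pow_left₀ 2 dist_nonneg (by nlinarith)
  exact h5.not_ge (hT.dist_le huv hwv h4)

/-- Every edge of a minimum spanning tree is in every Delaunay triangulation. -/
theorem IsMST.le_delaunay {T D : SimpleGraph V} (hT : IsMST ⊤ T)
    (hD : IsDelaunayTriangulation V D) : T ≤ D := by
  intro u v huv
  have hdisc := hT.diametral_disc huv
  have hDuv : IsDelaunayPair u v := by
    refine ⟨((u : ℂ) + v) / 2, ?_, fun w => ?_⟩
    · rw [dist_eq_norm, dist_eq_norm, ← norm_neg]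
      congr 1
      ring
    · have h0 : 0 ≤ ((w : ℂ) - u).re * ((w : ℂ) - v).re + ((w : ℂ) - u).im * ((w : ℂ) - v).im := by
        by_cases h1 : w = u
        · simp [h1]
        by_cases h2 : w = v
        · simp [h2]
        exact (hdisc w h1 h2).le
      rw [dist_eq_norm, dist_eq_norm]
      refine le_of_sq_le_sq ?_ (norm_nonneg _)
      rw [← Complex.normSq_eq_norm_sq, ← Complex.normSq_eq_norm_sq, Complex.normSq_apply,
        Complex.normSq_apply]
      simp at h0 ⊢
      nlinarith
  -- By maximality of `D` it suffices that `D` with `uv` added is still plane and Delaunay.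
  have hsup := hD.2 (y := D ⊔ SimpleGraph.fromEdgeSet {s(u, v)}) ?_ le_sup_left
  · exact hsup (by simp [huv.ne])
  have hadj : ∀ a b, (D ⊔ SimpleGraph.fromEdgeSet {s(u, v)}).Adj a b →
      D.Adj a b ∨ s(u, v) = s(a, b) := fun a b h => by
    rcases h with h | h
    · exact .inl h
    · exact .inr ((SimpleGraph.fromEdgeSet_adj _).1 h).1.symm
  have hseg : ∀ a b, s(u, v) = s(a, b) →
      openSegment ℝ (a : ℂ) b = openSegment ℝ (u : ℂ) v := fun a b h => by
    rcases Sym2.eq_iff.1 h with ⟨rfl, rfl⟩ | ⟨rfl, rfl⟩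
    · rfl
    · exact openSegment_symm _ _ _
  refine ⟨fun a b c d hab hcd hne => ?_, fun a b hab => ?_⟩
  · rcases hadj a b hab with h | h <;> rcases hadj c d hcd with h' | h'
    · exact hD.1.1 a b c d h h' hne
    · rw [hseg c d h', disjoint_comm]
      exact disjoint_openSegment_of_isDelaunayPair hdisc (h' ▸ hne.symm) hab.ne (hD.1.2 a b h)
    · rw [hseg a b h]
      exact disjoint_openSegment_of_isDelaunayPair hdisc (h ▸ hne) hcd.ne (hD.1.2 c d h')
    · exact absurd (h.symm.trans h') hne
  · rcases hadj a b hab with h | h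
    · exact hD.1.2 a b h
    · rcases Sym2.eq_iff.1 h with ⟨rfl, rfl⟩ | ⟨rfl, rfl⟩
      · exact hDuv
      · obtain ⟨c, h1, h2⟩ := hDuv
        exact ⟨c, h1.symm, fun w => h1 ▸ h2 w⟩

/-- An edge of a minimum spanning tree is a shortest one at small angles to it. -/
theorem IsMST.dist_le_of_angle_lt {T : SimpleGraph V} (hT : IsMST ⊤ T) {u v w : V}
    (huv : T.Adj u v) (huw : u ≠ w)
    (h : InnerProductGeometry.angle ((v : ℂ) - u) ((w : ℂ) - u) < π / 3) :
    dist (u : ℂ) v ≤ dist (u : ℂ) w := by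
  by_contra! hlt
  have hwv : w ≠ v := by rintro rfl; exact lt_irrefl _ hlt
  refine hlt.not_ge (hT.dist_le huv hwv ?_)
  have := norm_sub_lt_of_angle_lt (sub_ne_zero.2 (coe_ne huw).symm)
    (by rw [← dist_eq_norm, ← dist_eq_norm, dist_comm, dist_comm (v : ℂ)]; exact hlt.le) h
  rwa [sub_sub_sub_cancel_right, ← dist_eq_norm, ← dist_eq_norm, dist_comm (v : ℂ) u] at this

theorem IsConePartition.angle_lt {θ : ℝ} (hθ : θ < π / 3) {C : Fin (kappa θ) → ConvexCone ℝ ℂ}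
    (hC : IsConePartition θ C) {i : Fin (kappa θ)} {u v w : V} (huv : u ≠ v) (huw : u ≠ w)
    (hv : (v : ℂ) - u ∈ C i) (hw : (w : ℂ) - u ∈ C i) :
    InnerProductGeometry.angle ((v : ℂ) - u) ((w : ℂ) - u) < π / 3 :=
  (hC.1 i _ hv _ hw (sub_ne_zero.2 (coe_ne huv).symm)
    (sub_ne_zero.2 (coe_ne huw).symm)).trans_lt hθ

variable {θ : ℝ} {D T : SimpleGraph V} {C : V → Fin (kappa θ) → ConvexCone ℝ ℂ}
  {mid : V → Fin (kappa θ) → V}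

/-- An edge of a minimum spanning tree is extreme at one of its ends in the cone it lies in. -/
theorem IsMST.isExtreme_or (hθ : θ < π / 3) (hD : IsDelaunayTriangulation V D)
    (hC : ∀ u, IsConePartition θ (C u)) (hT : IsMST ⊤ T) {u v : V} (huv : T.Adj u v)
    {i j : Fin (kappa θ)} (hi : (v : ℂ) - u ∈ C u i) (hj : (u : ℂ) - v ∈ C v j) :
    IsExtreme D (C u i) u v ∨ IsExtreme D (C v j) v u := by
  have hDuv := hT.le_delaunay hD huv
  by_contra! hcon
  obtain ⟨h1, h2⟩ := hcon
  simp only [IsExtreme, not_and_or, not_or] at h1 h2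
  -- After `v` as seen from `u` and before `u` as seen from `v` are the same side of `uv`, so the
  -- edges `ux` and `vy` found there must cross.
  have h1' := (h1.resolve_left (not_not.2 ⟨hDuv, hi⟩)).2
  have h2' := (h2.resolve_left (not_not.2 ⟨hDuv.symm, hj⟩)).1
  obtain ⟨x, ⟨hux, hxK⟩, hx⟩ := Set.nonempty_iff_ne_empty.2 h1'
  obtain ⟨y, ⟨hvy, hyK⟩, hy⟩ := Set.nonempty_iff_ne_empty.2 h2'
  have hax := (hC u).angle_lt hθ huv.ne hux.ne hi hxK
  have hay := (hC v).angle_lt hθ huv.ne.symm hvy.ne hj hyK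
  refine not_disjoint_openSegment (coe_ne huv.ne) hax hay (hT.dist_le_of_angle_lt huv hux.ne hax)
    (hT.dist_le_of_angle_lt huv.symm hvy.ne hay) hx hy (hD.1.1 u x v y hux hvy fun h => ?_)
  rcases Sym2.eq_iff.1 h with ⟨h, -⟩ | ⟨-, rfl⟩
  · exact huv.ne h
  · simp only [cross] at hx
    linarith [mul_comm ((x : ℂ) - u).re ((x : ℂ) - u).im]

theorem exists_mem_cone (hC : ∀ u, IsConePartition θ (C u)) {u v : V} (huv : u ≠ v) :
    ∃ i, (v : ℂ) - u ∈ C u i :=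
  ((hC u).2 _ (sub_ne_zero.2 (coe_ne huv).symm)).exists

/-- An edge of a minimum spanning tree that is not protected at one end can be exchanged for an edge
of the bounded degree graph. -/
theorem IsMST.exists_exchange (hθ : θ < π / 3) (hD : IsDelaunayTriangulation V D)
    (hC : ∀ u, IsConePartition θ (C u)) (hmid : IsMiddleChoice D C mid) (hT : IsMST ⊤ T) {u v : V}
    (huv : T.Adj u v) (hnot : ¬ IsProtected D C mid u v) :
    ∃ w, u ≠ w ∧ (bdg D C mid).Adj u w ∧ IsMST ⊤ (LightGraph.exchange T s(u, v) s(u, w)) := by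
  obtain ⟨i, hi⟩ := exists_mem_cone hC huv.ne
  have hDuv := hT.le_delaunay hD huv
  have hv : v ∈ coneRest D (C u i) u :=
    ⟨⟨hDuv, hi⟩, fun h => hnot ⟨i, .inl h⟩, fun h => hnot ⟨i, .inr (.inl h)⟩⟩
  obtain ⟨hw, hmin⟩ := hmid u i ⟨v, hv⟩
  set w := mid u i with hwdef
  have huw : u ≠ w := hw.1.1.ne
  have hwv : w ≠ v := fun h => hnot ⟨i, .inr (.inr ⟨hv, by rw [← hwdef, h]⟩)⟩
  have hang := (hC u).angle_lt hθ huv.ne huw hi hw.1.2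
  have hle : dist (u : ℂ) w ≤ dist (u : ℂ) v := hmin v hv
  have hvw : dist (v : ℂ) w < dist (u : ℂ) v := by
    have := norm_sub_lt_of_angle_lt (sub_ne_zero.2 (coe_ne huw).symm)
      (by rw [← dist_eq_norm, ← dist_eq_norm, dist_comm, dist_comm (v : ℂ)]; exact hle) hang
    rwa [sub_sub_sub_cancel_right, ← dist_eq_norm, ← dist_eq_norm, dist_comm (v : ℂ) u] at this
  have hT' := (hT.exchange huv hwv hvw hle).2
  have huwT : (LightGraph.exchange T s(u, v) s(u, w)).Adj u w := by
    rw [← SimpleGraph.mem_edgeSet, edgeSet_exchange T _ huw]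
    exact Set.mem_insert _ _
  obtain ⟨j, hj⟩ := exists_mem_cone hC huw.symm
  refine ⟨w, huw, ⟨hw.1.1, ⟨i, .inr (.inr ⟨hw, rfl⟩)⟩, ⟨j, .inl ?_⟩⟩, hT'⟩
  -- The edge `uw` belongs to the new minimum spanning tree and, being a middle edge, is not extreme
  -- at `u`; hence it is extreme at `w`.
  exact (hT'.isExtreme_or hθ hD hC huwT hw.1.2 hj).resolve_left hw.2.1

/-- The bounded degree graph contains a minimum spanning tree. -/
theorem IsMST.exists_le_bdg (hθ : θ < π / 3) (hD : IsDelaunayTriangulation V D)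
    (hC : ∀ u, IsConePartition θ (C u)) (hmid : IsMiddleChoice D C mid) (hT : IsMST ⊤ T) :
    ∃ T', IsMST ⊤ T' ∧ T' ≤ bdg D C mid := by
  induction hn : (T.edgeSet \ (bdg D C mid).edgeSet).ncard using Nat.strong_induction_on
    generalizing T with
  | _ n ih =>
  subst hn
  by_cases hle : T ≤ bdg D C mid
  · exact ⟨T, hT, hle⟩
  obtain ⟨u, v, huv, hnot⟩ : ∃ u v, T.Adj u v ∧ ¬ IsProtected D C mid u v := by
    by_contra! hcon
    exact hle fun u v h => ⟨hT.le_delaunay hD h, hcon u v h, hcon v u h.symm⟩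
  obtain ⟨w, huw, hadj, hT'⟩ := hT.exists_exchange hθ hD hC hmid huv hnot
  -- The number of tree edges outside the bounded degree graph drops: `uv` was one of them, and `uw`
  -- is not.
  refine ih _ (Set.ncard_lt_ncard ?_ (Set.toFinite _)) hT' rfl
  rw [edgeSet_exchange T _ huw, Set.ssubset_iff_of_subset]
  · exact ⟨s(u, v), ⟨huv, fun h => hnot h.2.1⟩, fun h => by
      rcases h.1 with h' | h'
      · exact h.2 (h' ▸ hadj)
      · exact h'.2 rfl⟩
  · rintro e ⟨rfl | he, h⟩
    · exact absurd hadj h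
    · exact ⟨he.1, h⟩

end Containment

/-! ### The potential of the protocol. -/

section Protocol

variable {V : Finset ℂ}

/-- The sum of the weights of the edges of the polygon. -/
def LLState.perimeter (σ : LLState V) : ℝ :=
  (σ.polygon.toMultiset.map fun e => σ.wt s(e.1, e.2)).sum

/-- What every state that the protocol reaches satisfies, for a bound `b` on the length of the
included edges plus `r` times the weight of the polygon. -/
structure LLState.Invariant (r b : ℝ) (σ : LLState V) : Prop where
  settled : ∀ e ∈ σ.polygon, s(e.1, e.2) ∈ σ.included ∪ σ.excluded
  wt_nonneg : ∀ e ∈ σ.included ∪ σ.excluded, 0 ≤ σ.wt e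
  bound : ∑ e ∈ (Set.toFinite σ.included).toFinset, len e + r * σ.perimeter ≤ b

theorem LLState.perimeter_eq {σ : LLState V} {path rest : List (V × V)}
    (h : σ.polygon = ((path ++ rest : List (V × V)) : Cycle (V × V))) :
    σ.perimeter = σ.pathWeight path + σ.pathWeight rest := by
  simp [LLState.perimeter, h, LLState.pathWeight]

theorem LLState.sum_update_eq_pathWeight {σ : LLState V} {e : Sym2 V} {x : ℝ}
    [DecidableEq (Sym2 V)] {l : List (V × V)} (h : ∀ d ∈ l, s(d.1, d.2) ≠ e) :
    (l.map fun d => Function.update σ.wt e x s(d.1, d.2)).sum = σ.pathWeight l := by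
  congr 1
  exact List.map_congr_left fun d hd => Function.update_of_ne (h d hd) _ _

theorem LLStep.invariant {G : SimpleGraph V} {r b : ℝ} (hr : 0 < r) {σ τ : LLState V}
    (hστ : LLStep G r σ τ) (hσ : σ.Invariant r b) : τ.Invariant r b := by
  classical
  have hrest : ∀ {p q path rest}, σ.CanExpand G p q path rest →
      ∀ d ∈ rest, s(d.1, d.2) ∈ σ.included ∪ σ.excluded := fun h d hd =>
    hσ.settled d (by rw [h.polygon_eq, Cycle.mem_coe_iff]; exact List.mem_append_right _ hd)
  -- An unsettled edge is not on the polygon, so relabelling it leaves the weight of `rest`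
  -- unchanged.
  have hne : ∀ {p q path rest}, σ.CanExpand G p q path rest →
      ∀ d ∈ σ.included ∪ σ.excluded, d ≠ s(p, q) := by
    rintro p q path rest h d hd rfl
    exact hd.elim h.unsettled.2.1 h.unsettled.2.2
  cases hστ with
  | include_edge p q path rest h hS =>
    refine ⟨fun d hd => ?_, fun e he => ?_, ?_⟩
    · rw [Cycle.mem_coe_iff, List.mem_cons] at hd
      rcases hd with rfl | hd
      · exact .inl (.inl rfl)
      · exact (hrest h d hd).imp .inr id
    · by_cases heq : e = s(p, q)
      · subst heq
        simp
      · dsimp only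
        rw [Function.update_of_ne heq]
        exact hσ.wt_nonneg e (he.imp (fun h => h.resolve_left heq) id)
    · have hb := hσ.bound
      rw [LLState.perimeter_eq h.polygon_eq] at hb
      have hfin : (Set.toFinite (insert s(p, q) σ.included)).toFinset =
          insert s(p, q) (Set.toFinite σ.included).toFinset := by ext; simp
      rw [hfin, Finset.sum_insert (by simpa using h.unsettled.2.1), len_mk]
      simp only [LLState.perimeter, Cycle.coe_toMultiset, Multiset.map_coe, Multiset.sum_coe,
        List.map_cons, List.sum_cons, Function.update_self]
      rw [LLState.sum_update_eq_pathWeight fun d hd => hne h _ (hrest h d hd)]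
      have hd : dist (p : ℂ) q = dist p q := rfl
      -- The drop in `r` times the perimeter pays for the included length `|pq|`.
      have hr' : r * ((1 + 1 / r) * dist p q) = r * dist p q + dist p q := by field_simp
      have := mul_lt_mul_of_pos_left hS hr
      rw [hd]
      linarith
  | exclude_edge p q path rest h hS =>
    have hpath : 0 ≤ σ.pathWeight path := by
      refine List.sum_nonneg fun x hx => ?_
      obtain ⟨d, hd, rfl⟩ := List.mem_map.1 hx
      exact hσ.wt_nonneg _ (hσ.settled d
        (by rw [h.polygon_eq, Cycle.mem_coe_iff]; exact List.mem_append_left _ hd))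
    refine ⟨fun d hd => ?_, fun e he => ?_, ?_⟩
    · rw [Cycle.mem_coe_iff, List.mem_cons] at hd
      rcases hd with rfl | hd
      · exact .inr (.inl rfl)
      · exact (hrest h d hd).imp id .inr
    · by_cases heq : e = s(p, q)
      · subst heq
        simpa using hpath
      · dsimp only
        rw [Function.update_of_ne heq]
        exact hσ.wt_nonneg e (he.imp id fun h => h.resolve_left heq)
    · have hb := hσ.bound
      rw [LLState.perimeter_eq h.polygon_eq] at hb
      simp only [LLState.perimeter, Cycle.coe_toMultiset, Multiset.map_coe, Multiset.sum_coe,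
        List.map_cons, List.sum_cons, Function.update_self]
      rw [LLState.sum_update_eq_pathWeight fun d hd => hne h _ (hrest h d hd)]
      exact hb

theorem perimeter_init_le {T : SimpleGraph V} {P : Cycle (V × V)} (hP : IsEulerTour T P) :
    (LLState.init T P).perimeter ≤ 2 * weight T := by
  classical
  obtain ⟨hnd, hmem, -⟩ := hP
  induction P using Quotient.inductionOn with
  | _ l =>
  change l.Nodup at hnd
  change ∀ a b, (a, b) ∈ l ↔ T.Adj a b at hmem
  change (l.map fun d => len s(d.1, d.2)).sum ≤ _
  -- Group the directed edges by underlying edge: at most two, `(a, b)` and `(b, a)`, lie over each.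
  rw [← List.sum_toFinset _ hnd, weight, Finset.mul_sum,
    ← Finset.sum_fiberwise_of_maps_to (g := fun d : V × V => s(d.1, d.2))
      (t := (Set.toFinite T.edgeSet).toFinset) fun d hd => by
        simpa using (hmem d.1 d.2).1 (List.mem_toFinset.1 hd)]
  refine Finset.sum_le_sum fun e _ => ?_
  rw [Finset.sum_congr rfl fun d hd => by rw [(Finset.mem_filter.1 hd).2], Finset.sum_const,
    nsmul_eq_mul]
  refine mul_le_mul_of_nonneg_right ?_ (len_nonneg e)
  induction e with
  | h a b =>
  refine mod_cast (Finset.card_le_card (t := {(a, b), (b, a)}) fun d hd => ?_).trans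
    Finset.card_le_two
  simpa [Prod.ext_iff] using (Finset.mem_filter.1 hd).2

theorem LLState.init_invariant {T : SimpleGraph V} {P : Cycle (V × V)} (hP : IsEulerTour T P)
    {r : ℝ} (hr : 0 < r) : (LLState.init T P).Invariant r ((2 * r + 1) * weight T) := by
  refine ⟨fun d hd => .inl ((hP.2.1 d.1 d.2).1 hd), fun e _ => len_nonneg e, ?_⟩
  have := mul_le_mul_of_nonneg_left (perimeter_init_le hP) hr.le
  change weight T + r * _ ≤ _
  linarith

theorem weight_le_of_isLLOutput {G L : SimpleGraph V} {r : ℝ} (hr : 0 < r)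
    (h : IsLLOutput G r L) : ∃ T, IsMST G T ∧ weight L ≤ (2 * r + 1) * weight T := by
  obtain ⟨T, P, σ, hT, hP, hσ, -, rfl⟩ := h
  refine ⟨T, hT, ?_⟩
  have hinv : σ.Invariant r ((2 * r + 1) * weight T) := by
    induction hσ with
    | refl => exact LLState.init_invariant hP hr
    | tail _ hstep ih => exact hstep.invariant hr ih
  have hper : 0 ≤ σ.perimeter := by
    refine Multiset.sum_nonneg fun x hx => ?_
    obtain ⟨d, hd, rfl⟩ := Multiset.mem_map.1 hx
    refine hinv.wt_nonneg _ (hinv.settled d ?_)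
    induction hP : σ.polygon using Quotient.inductionOn with
    | _ l => rw [hP] at hd; exact hd
  -- `fromEdgeSet` discards loops, so a priori the edges of the output only form a subset of
  -- `σ.included`.
  refine le_trans (Finset.sum_le_sum_of_subset_of_nonneg ?_ fun e _ _ => len_nonneg e)
    ((le_add_of_nonneg_right (mul_nonneg hr.le hper)).trans hinv.bound)
  intro e he
  simp at he ⊢
  exact he.1

end Protocol

end LightGraph

theorem mainTheorem11 (V : Finset ℂ) (θ r : ℝ) (hθ_pos : 0 < θ) (hθ : θ < π / 3) (hr : 0 < r)
    (L : SimpleGraph V) (hL : LightGraph.IsLMBDG V θ r L)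
    (T : SimpleGraph V) (hT : LightGraph.IsMST (⊤ : SimpleGraph V) T) :
    LightGraph.weight L ≤ (2 * r + 1) * LightGraph.weight T := by
  obtain ⟨G, ⟨D, C, mid, hD, hC, hmid, rfl⟩, hout⟩ := hL
  obtain ⟨T₀, hT₀, hle⟩ := LightGraph.weight_le_of_isLLOutput hr hout
  obtain ⟨T₁, hT₁, hT₁G⟩ := hT.exists_le_bdg hθ hD hC hmid
  have h1 := hT₀.2.2 T₁ hT₁G hT₁.2.1
  have h2 := hT₁.2.2 T le_top hT.2.1
  exact hle.trans (mul_le_mul_of_nonneg_left (h1.trans h2) (by linarith))
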